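/- A linearly ordered poset is a structure $\mathcal{A}=(A,\sqsubseteq,<)$ where $\sqsubseteq$ is a partial order on the set $A$ and $<$ is a strict linear order on $A$ such that $a\sqsubseteq b$ and $a\neq b$ imply $a<b$. An embedding $\mathcal{A}\hookrightarrow\mathcal{B}$ is an injective map that preserves and reflects both relations; an isomorphism is a surjective embedding. For $\mathcal{A}$ and $\mathcal{C}$ let $\binom{\mathcal{C}}{\mathcal{A}}$ be the set of all substructures of $\mathcal{C}$ isomorphic to $\mathcal{A}$. Write $\mathcal{C}\longrightarrow(\mathcal{B})^{\mathcal{A}}_k$ if for every partition $\binom{\mathcal{C}}{\mathcal{A}}=\mathcal{X}_1\cup\dots\cup\mathcal{X}_k$ (into possibly empty classes) there are $\tilde{\mathcal{B}}\in\binom{\mathcal{C}}{\mathcal{B}}$ and $j$ with $\binom{\tilde{\mathcal{B}}}{\mathcal{A}}\subseteq\mathcal{X}_j$. A class $\mathbf{K}$ of linearly ordered posets has the Ramsey property if for all finite $\mathcal{A},\mathcal{B}\in\mathbf{K}$ with $\mathcal{A}\hookrightarrow\mathcal{B}$ and every integer $k\ge2$ there is a finite $\mathcal{C}\in\mathbf{K}$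 with $\mathcal{C}\longrightarrow(\mathcal{B})^{\mathcal{A}}_k$. For a positive integer $n$ let $\Pi_n=(\mathcal{P}(\{1,\dots,n\}),\supseteq,<_{\overline{lex}})$, where $S<_{\overline{lex}}T$ if and only if $S\supsetneq T$, or $S$ and $T$ are incomparable under inclusion and $\min(S\setminus T)<\min(T\setminus S)$. **Theorem 3.2.** (a) For every $k\ge2$ and all finite linearly ordered posets $\mathcal{A},\mathcal{B}$ with $\mathcal{A}\hookrightarrow\mathcal{B}$ there is a positive integer $N$ such that $\Pi_N\longrightarrow(\mathcal{B})^{\mathcal{A}}_k$. (b) Let $\mathbf{K}^*$ be a class of linearly ordered posets which contains, for every positive integer $n$, the poset $\Pi_n$ or at least an isomorphic copy of it. Then $\mathbf{K}^*$ has the Ramsey property. In particular, the class of all finite linearly ordered posets has the Ramsey property, and so does the class of all linearly ordered posets. -/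

import Mathlib

universe u v w

/-- A linearly ordered poset: a set with a partial order `le` and a (strict) linear order `lt`
which extends the partial order. The underlying set may have any cardinality. -/
structure LinOrdPoset : Type (u + 1) where
  /-- the underlying set -/
  carrier : Type u
  /-- the partial order -/
  le : carrier → carrier → Prop
  /-- the strict linear order -/
  lt : carrier → carrier → Prop
  le_refl : ∀ a, le a a
  le_trans : ∀ a b c, le a b → le b c → le a c
  le_antisymm : ∀ a b, le a b → le b a → a = b
  lt_irrefl : ∀ a, ¬ lt a a
  lt_trans : ∀ a b c, lt a b → lt b c → lt a c
  lt_trichotomy : ∀ a b, lt a b ∨ a = b ∨ lt b a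
  lt_of_le_of_ne : ∀ a b, le a b → a ≠ b → lt a b

namespace LinOrdPoset

/-- `f` is an embedding of relational structures: injective, and preserving and reflecting both
relations. -/
structure IsEmbedding (A : LinOrdPoset.{u}) (B : LinOrdPoset.{v})
    (f : A.carrier → B.carrier) : Prop where
  injective : Function.Injective f
  le_iff : ∀ a b, A.le a b ↔ B.le (f a) (f b)
  lt_iff : ∀ a b, A.lt a b ↔ B.lt (f a) (f b)

/-- `A ↪ B`. -/
def Embeds (A : LinOrdPoset.{u}) (B : LinOrdPoset.{v}) : Prop :=
  ∃ f : A.carrier → B.carrier, IsEmbedding A B f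

/-- `A ≅ B`: there is a surjective embedding of `A` into `B`. -/
def Isomorphic (A : LinOrdPoset.{u}) (B : LinOrdPoset.{v}) : Prop :=
  ∃ f : A.carrier → B.carrier, IsEmbedding A B f ∧ Function.Surjective f

/-- The substructure of `C` with underlying set `S`. (The language is relational, so that every
subset carries exactly one substructure.) -/
def restrict (C : LinOrdPoset.{u}) (S : Set C.carrier) : LinOrdPoset.{u} where
  carrier := S
  le a b := C.le a b
  lt a b := C.lt a b
  le_refl a := C.le_refl a
  le_trans a b c := C.le_trans a b c
  le_antisymm a b h h' := Subtype.ext (C.le_antisymm a b h h')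
  lt_irrefl a := C.lt_irrefl a
  lt_trans a b c := C.lt_trans a b c
  lt_trichotomy a b := by
    rcases C.lt_trichotomy a b with h | h | h
    · exact Or.inl h
    · exact Or.inr (Or.inl (Subtype.ext h))
    · exact Or.inr (Or.inr h)
  lt_of_le_of_ne a b h h' := C.lt_of_le_of_ne a b h (fun e => h' (Subtype.ext e))

/-- `binom(C, A)`: the substructures of `C` that are isomorphic to `A`, each given by its
underlying set. -/
def copies (C : LinOrdPoset.{u}) (A : LinOrdPoset.{v}) : Set (Set C.carrier) :=
  {S | Isomorphic A (C.restrict S)}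

/-- The partition relation `C ⟶ (B)^A_k`: for every colouring of `binom(C, A)` by `k` colours
(that is, every partition into `k` possibly empty classes) there are a copy `B'` of `B` in `C` and
a colour `j` such that all the copies of `A` that lie in `B'` have colour `j`. -/
def Arrow (C : LinOrdPoset.{u}) (B : LinOrdPoset.{v}) (A : LinOrdPoset.{w}) (k : ℕ) : Prop :=
  ∀ χ : C.copies A → Fin k,
    ∃ B' ∈ C.copies B, ∃ j : Fin k,
      ∀ A' : C.copies A, (A' : Set C.carrier) ⊆ B' → χ A' = j

/-- The Ramsey property of a class `K` of linearly ordered posets. It speaks about the finite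
members of `K`; for a class of finite structures the finiteness clauses are void. -/
def HasRamseyProperty (K : LinOrdPoset.{u} → Prop) : Prop :=
  ∀ A B : LinOrdPoset.{u}, K A → K B → Finite A.carrier → Finite B.carrier → Embeds A B →
    ∀ k : ℕ, 2 ≤ k → ∃ C : LinOrdPoset.{u}, K C ∧ Finite C.carrier ∧ Arrow C B A k

/-- The strict complemented lexicographic order on subsets of an `n`-element chain: `S` precedes
`T` if `S` properly contains `T`, or if `S` and `T` are incomparable under inclusion and
`min (S \ T) < min (T \ S)`. -/
def clexLT {n : ℕ} (S T : Finset (Fin n)) : Prop :=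
  T ⊂ S ∨ (¬ S ⊆ T ∧ ¬ T ⊆ S ∧ (S \ T).min < (T \ S).min)

/-- `S` precedes `T` iff the first position at which they differ belongs to `S`. -/
theorem clexLT_iff {n : ℕ} (S T : Finset (Fin n)) :
    clexLT S T ↔ ∃ x ∈ S, x ∉ T ∧ ∀ y < x, (y ∈ S ↔ y ∈ T) := by
  constructor
  · intro h
    have hne : (S \ T).Nonempty := by
      rw [Finset.sdiff_nonempty]
      rcases h with h | h
      · exact h.2
      · exact h.1
    obtain ⟨hxS, hxT⟩ := Finset.mem_sdiff.1 (Finset.min'_mem _ hne)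
    refine ⟨_, hxS, hxT, fun y hy => ⟨fun hyS => ?_, fun hyT => ?_⟩⟩
    · by_contra hyT
      exact absurd (Finset.min'_le _ y (Finset.mem_sdiff.2 ⟨hyS, hyT⟩)) (not_le.2 hy)
    · by_contra hyS
      rcases h with h | h
      · exact hyS (h.1 hyT)
      · have h1 := h.2.2
        rw [← Finset.coe_min' hne] at h1
        have h2 : (T \ S).min ≤ (y : WithTop (Fin n)) :=
          Finset.min_le (Finset.mem_sdiff.2 ⟨hyT, hyS⟩)
        exact absurd (WithTop.coe_lt_coe.1 (h1.trans_le h2)) (not_lt.2 hy.le)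
  · rintro ⟨x, hxS, hxT, hx⟩
    have hST : ¬ S ⊆ T := fun h => hxT (h hxS)
    by_cases hTS : T ⊆ S
    · exact Or.inl ⟨hTS, hST⟩
    · refine Or.inr ⟨hST, hTS, ?_⟩
      have hne : (T \ S).Nonempty := Finset.sdiff_nonempty.2 hTS
      obtain ⟨hyT, hyS⟩ := Finset.mem_sdiff.1 (Finset.min'_mem _ hne)
      rw [← Finset.coe_min' hne]
      refine (Finset.min_le (Finset.mem_sdiff.2 ⟨hxS, hxT⟩)).trans_lt
        (WithTop.coe_lt_coe.2 ?_)
      rcases _root_.lt_trichotomy x ((T \ S).min' hne) with h | h | h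
      · exact h
      · exact absurd (h ▸ hyT) hxT
      · exact absurd ((hx _ h).2 hyT) hyS

/-- The linearly ordered poset `Π_n`: all subsets of an `n`-element chain (`Fin n` in the role of
`{1, …, n}`), with reverse inclusion as the partial order and the complemented lexicographic order
as the linear order. -/
def PiPoset (n : ℕ) : LinOrdPoset.{0} where
  carrier := Finset (Fin n)
  le S T := T ⊆ S
  lt S T := clexLT S T
  le_refl S := Finset.Subset.refl S
  le_trans _ _ _ h h' := h'.trans h
  le_antisymm _ _ h h' := Finset.Subset.antisymm h' h
  lt_irrefl S h := by
    obtain ⟨x, hx, hx', -⟩ := (clexLT_iff S S).1 h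
    exact hx' hx
  lt_trans S T U h h' := by
    rw [clexLT_iff] at h h' ⊢
    obtain ⟨x, hxS, hxT, hx⟩ := h
    obtain ⟨y, hyT, hyU, hy⟩ := h'
    rcases _root_.lt_trichotomy x y with hxy | hxy | hxy
    · exact ⟨x, hxS, fun hU => hxT ((hy x hxy).2 hU),
        fun z hz => (hx z hz).trans (hy z (hz.trans hxy))⟩
    · exact absurd (hxy ▸ hyT) hxT
    · exact ⟨y, (hx y hxy).2 hyT, hyU,
        fun z hz => (hx z (hz.trans hxy)).trans (hy z hz)⟩
  lt_trichotomy S T := by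
    by_cases hST : S = T
    · exact Or.inr (Or.inl hST)
    have hne : (symmDiff S T).Nonempty := by
      rw [Finset.nonempty_iff_ne_empty]
      intro h
      exact hST (symmDiff_eq_bot.1 h)
    have hmin : ∀ y < (symmDiff S T).min' hne, (y ∈ S ↔ y ∈ T) := by
      intro y hy
      by_contra hyn
      refine absurd (Finset.min'_le (symmDiff S T) y ?_) (not_le.2 hy)
      rw [Finset.mem_symmDiff]
      tauto
    rw [clexLT_iff, clexLT_iff]
    rcases Finset.mem_symmDiff.1 (Finset.min'_mem _ hne) with h | h
    · exact Or.inl ⟨_, h.1, h.2, hmin⟩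
    · exact Or.inr (Or.inr ⟨_, h.1, h.2, fun y hy => (hmin y hy).symm⟩)
  lt_of_le_of_ne _ _ h hne := Or.inl (Finset.ssubset_iff_subset_ne.2 ⟨h, hne.symm⟩)

end LinOrdPoset

/-!
Both parts rest on a finite dual Ramsey theorem (the Graham–Rothschild theorem in the form of
rigid words), applied to words whose letters are the downsets of a poset.

**From posets to words.** A map `f` from a poset `A` to the subsets of an `N`-element chain is the
same thing as a word of length `N` over the subsets of `A`: its letter at `x` is
`{a | x ∈ f a}`. If `f` is an embedding into `Π_N`, all letters are downsets. Enumerate the downsets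
of `A` in the colexicographic order induced by the linear order of `A`. The principal downset of
`a` is the first downset that contains `a`, and if `a < b` it comes before every downset that
contains `b`; hence each word in which all downsets occur, with first occurrences in increasing
order (a *rigid* word), gives an embedding into `Π_N`
(`LinOrdPoset.IsDownsetEnum.isEmbedding_wordMap`). If `g : A → B` is an embedding, taking preimages
under `g` turns the list of all downsets of `B` into a rigid word over the downsets of `A`, because
the first downset of `B` with preimage `E` is the downset generated by `g '' E`, and this is strictly
monotone in `E` (`LinOrdPoset.IsDownsetEnum.isRigid_map_range`).

**The dual Ramsey theorem.** A word with `n` parameters acts on words of length at most `n` by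
substitution. This action is recorded by the three properties in `IsSubst`, which are stable under
composition. The theorem `exists_isSubst_rigid_monochromatic` says that for every colouring of words
there is a substitution `Φ` such that all `Φ p`, for `p` a rigid word with `m` letters and of length
at most `n`, have the same colour. Working with all lengths up to `n` at once makes an induction on
`m` possible: a rigid word with `m + 1` letters is `p ++ m :: q` with `p` rigid with `m` letters and
`q` arbitrary, and by fusion over the length of `p` one makes the colour independent of `q`
(`exists_isSubst_tail_invariant_below`). For a single length of `p` this is a Hales–Jewett
statement for words of variable length (`exists_isSubst_tail_invariant`): iterating the
Hales–Jewett theorem makes the colour depend on the length of `q` only, and the pigeonhole principle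
then selects lengths of one colour.

Applying `Φ` to the list of all downsets of `B` gives a copy of `B` in `Π_N` all of whose copies of
`A` come from words `Φ p` with `p` rigid, and so have one colour. The statements about classes
follow by transport along isomorphisms.
-/

universe x

/-! ### Substitutions on words -/

/-- The properties used of the substitution map of a parameter word `W`, which sends a word `p` of
length `i` to the part of `W` before its `(i + 1)`-st parameter, with the first `i` parameters
replaced by the letters of `p`. It commutes with relabelling letters, it introduces no new letters
(all constants of `W` count as repeated parameters), and appending letters to `p` appends to the
image a word that starts with the first of these letters. -/
structure IsSubst (Φ : List ℕ → List ℕ) : Prop where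
  map : ∀ (f : ℕ → ℕ) (p : List ℕ), Φ (p.map f) = (Φ p).map f
  subset : ∀ p, Φ p ⊆ p
  append_cons : ∀ p b q, ∃ r, Φ (p ++ b :: q) = Φ p ++ b :: r

namespace IsSubst

variable {Φ Ψ : List ℕ → List ℕ}

protected theorem id : IsSubst id :=
  ⟨fun _ _ => rfl, fun _ => List.Subset.refl _, fun _ _ q => ⟨q, rfl⟩⟩

theorem comp (hΦ : IsSubst Φ) (hΨ : IsSubst Ψ) : IsSubst (Φ ∘ Ψ) where
  map f p := by simp [hΨ.map, hΦ.map]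
  subset p := List.Subset.trans (hΦ.subset _) (hΨ.subset p)
  append_cons p b q := by
    obtain ⟨r, hr⟩ := hΨ.append_cons p b q
    obtain ⟨s, hs⟩ := hΦ.append_cons (Ψ p) b r
    exact ⟨s, by simp [hr, hs]⟩

theorem mem_iff (hΦ : IsSubst Φ) (p : List ℕ) (x : ℕ) : x ∈ Φ p ↔ x ∈ p := by
  refine ⟨fun h => hΦ.subset p h, fun h => ?_⟩
  obtain ⟨s, t, rfl⟩ := List.append_of_mem h
  obtain ⟨r, hr⟩ := hΦ.append_cons s x t
  simp [hr]

/-- The length of the image depends only on the length of the word, since relabelling all letters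
by `0` preserves lengths. -/
theorem length_congr (hΦ : IsSubst Φ) {p q : List ℕ} (h : p.length = q.length) :
    (Φ p).length = (Φ q).length := by
  have hc : p.map (fun _ => 0) = q.map (fun _ => 0) := by
    simp [List.map_const', h]
  have := congrArg List.length ((hΦ.map _ p).symm.trans ((congrArg Φ hc).trans (hΦ.map _ q)))
  simpa using this

theorem length_mono (hΦ : IsSubst Φ) {p q : List ℕ} (h : p.length ≤ q.length) :
    (Φ p).length ≤ (Φ q).length := by
  have h1 : (q.take p.length).length = p.length := by simp [h]
  rw [hΦ.length_congr h1.symm]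
  rcases hd : q.drop p.length with _ | ⟨b, r⟩
  · have := List.take_append_drop p.length q
    rw [hd, List.append_nil] at this
    rw [this]
  · obtain ⟨s, hs⟩ := hΦ.append_cons (q.take p.length) b r
    rw [← hd, List.take_append_drop] at hs
    rw [hs]
    simp

theorem apply_range_append (hΦ : IsSubst Φ) {a : ℕ} (ha : 0 < a)
    (hid : ∀ p : List ℕ, p.length < a → Φ p = p) (q : List ℕ) :
    ∃ r, Φ (List.range a ++ q) = List.range a ++ r ∧ ∀ x ∈ r, x ∈ List.range a ++ q := by
  obtain ⟨a, rfl⟩ := Nat.exists_eq_succ_of_ne_zero ha.ne'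
  obtain ⟨r, hr⟩ := hΦ.append_cons (List.range a) a q
  have h1 : Φ (List.range (a + 1) ++ q) = List.range (a + 1) ++ r := by
    simpa [List.range_succ, hid (List.range a) (by simp)] using hr
  refine ⟨r, h1, fun x hx => hΦ.subset _ ?_⟩
  rw [Nat.succ_eq_add_one, h1]
  exact List.mem_append_right _ hx

end IsSubst

/-- The substitution map of the parameter word in which the `t`-th parameter (counted from `0`) is
followed by the block `e t`, whose entries `i` stand for the `i`-th parameter. It is a substitution
if the entries of `e t` are at most `t`, and the default value of `getD` is then never used. -/
def blockSubst (e : ℕ → List ℕ) (p : List ℕ) : List ℕ :=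
  (List.range p.length).flatMap fun t => p.getD t 0 :: (e t).map (p.getD · 0)

section blockSubst

variable {e : ℕ → List ℕ}

theorem blockSubst_append_singleton (he : ∀ t, ∀ i ∈ e t, i ≤ t) (p : List ℕ) (b : ℕ) :
    blockSubst e (p ++ [b]) =
      blockSubst e p ++ b :: (e p.length).map ((p ++ [b]).getD · 0) := by
  unfold blockSubst
  rw [List.length_append, List.length_singleton, List.range_succ, List.flatMap_append]
  congr 1
  · refine List.flatMap_congr fun t ht => ?_
    have ht' := List.mem_range.1 ht
    congr 1
    · exact List.getD_append _ _ _ _ ht'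
    · exact List.map_congr_left fun i hi =>
        List.getD_append _ _ _ _ ((he t i hi).trans_lt ht')
  · simp

theorem isSubst_blockSubst (he : ∀ t, ∀ i ∈ e t, i ≤ t) : IsSubst (blockSubst e) where
  map f p := by
    unfold blockSubst
    rw [List.map_flatMap, List.length_map]
    refine List.flatMap_congr fun t ht => ?_
    have ht' := List.mem_range.1 ht
    have hf : ∀ i ≤ t, (p.map f).getD i 0 = f (p.getD i 0) := by
      intro i hi
      have : i < p.length := hi.trans_lt ht'
      simp [this]
    rw [List.map_cons, hf t le_rfl, List.map_map]
    congr 1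
    exact List.map_congr_left fun i hi => hf i (he t i hi)
  subset p := by
    intro x hx
    simp only [blockSubst, List.mem_flatMap, List.mem_range, List.mem_cons, List.mem_map] at hx
    obtain ⟨t, ht, h⟩ := hx
    have hg : ∀ i ≤ t, p.getD i 0 ∈ p := by
      intro i hi
      have : i < p.length := hi.trans_lt ht
      simp [this]
    rcases h with rfl | ⟨i, hi, rfl⟩
    · exact hg t le_rfl
    · exact hg i (he t i hi)
  append_cons p b q := by
    induction q using List.reverseRecOn with
    | nil => exact ⟨_, blockSubst_append_singleton he p b⟩
    | append_singleton q c ih =>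
      obtain ⟨r, hr⟩ := ih
      refine ⟨r ++ c :: (e (p ++ b :: q).length).map ((p ++ b :: q ++ [c]).getD · 0), ?_⟩
      have := blockSubst_append_singleton he (p ++ b :: q) c
      rw [hr] at this
      simpa using this

theorem blockSubst_append_of_eq_nil (he : ∀ t, ∀ i ∈ e t, i ≤ t) (p q : List ℕ)
    (h : ∀ t, p.length ≤ t → t < p.length + q.length → e t = []) :
    blockSubst e (p ++ q) = blockSubst e p ++ q := by
  induction q using List.reverseRecOn with
  | nil => simp
  | append_singleton q c ih =>
    rw [← List.append_assoc, blockSubst_append_singleton he,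
      ih fun t h1 h2 => h t h1 (by simp; omega), h (p ++ q).length (by simp) (by simp)]
    simp

theorem blockSubst_eq_self (he : ∀ t, ∀ i ∈ e t, i ≤ t) (p : List ℕ)
    (h : ∀ t < p.length, e t = []) : blockSubst e p = p := by
  simpa [blockSubst] using blockSubst_append_of_eq_nil he [] p fun t _ ht => h t (by simpa using ht)

end blockSubst

/-! ### A Hales–Jewett theorem for words of variable length -/

/-- The Hales–Jewett theorem over the alphabet `{0, …, a - 1}`, in terms of substitutions. The word
`List.range a` at the front makes every letter of the alphabet available as a constant. The part of
a combinatorial line before its first active coordinate becomes the block after position `a - 1`, so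
that only words of length less than `a` are fixed. -/
theorem exists_isSubst_letter_invariant {a : ℕ} (ha : 0 < a) (K : Type) [Finite K] :
    ∃ M : ℕ, ∀ c : List ℕ → K, ∃ Φ, IsSubst Φ ∧ (∀ p : List ℕ, p.length < a → Φ p = p) ∧
      (∀ p q : List ℕ, p.length = a + 1 → Φ (p ++ q) = Φ p ++ q ∧ (Φ p).length = a + M) ∧
      ∀ b < a, ∀ b' < a, c (Φ (List.range a ++ [b])) = c (Φ (List.range a ++ [b'])) := by
  obtain ⟨ι, _, hι⟩ := Combinatorics.Line.exists_mono_in_high_dimension (Fin a) K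
  let σ := Fintype.equivFin ι
  refine ⟨Fintype.card ι, fun c => ?_⟩
  obtain ⟨l, k, hl⟩ := hι fun v => c (List.range a ++ List.ofFn fun i => (v (σ.symm i) : ℕ))
  -- the line as a word, in which the index `a` stands for the active coordinate
  let z : List ℕ := List.ofFn fun i => ((l.idxFun (σ.symm i)).map Fin.val).getD a
  have haz : a ∈ z := by
    obtain ⟨i, hi⟩ := l.proper
    rw [List.mem_ofFn]
    exact ⟨σ i, by simp [hi]⟩
  have hza : ∀ x ∈ z, x ≤ a := by
    intro x hx
    obtain ⟨i, rfl⟩ := List.mem_ofFn.1 hx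
    rcases l.idxFun (σ.symm i) with _ | t
    · exact le_rfl
    · simp
  obtain ⟨w, u, hz, haw⟩ := List.eq_append_cons_of_mem haz
  have hwa : ∀ x ∈ w, x < a := fun x hx =>
    lt_of_le_of_ne (hza x (by rw [hz]; simp [hx])) (fun h => haw (h ▸ hx))
  have hua : ∀ x ∈ u, x ≤ a := fun x hx => hza x (by rw [hz]; simp [hx])
  let e : ℕ → List ℕ := fun t => if t + 1 = a then w else if t = a then u else []
  have he : ∀ t, ∀ i ∈ e t, i ≤ t := by
    intro t i hi
    simp only [e] at hi
    split_ifs at hi with h1 h2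
    · have := hwa i hi; omega
    · exact (hua i hi).trans h2.ge
    · simp at hi
  have hid : ∀ p : List ℕ, p.length < a → blockSubst e p = p := fun p hp =>
    blockSubst_eq_self he p fun t ht => by simp only [e]; rw [if_neg, if_neg] <;> omega
  have key : ∀ (s : List ℕ) (b : ℕ), s.length = a →
      blockSubst e (s ++ [b]) = s ++ z.map ((s ++ [b]).getD · 0) := by
    intro s b hs
    have h1 : blockSubst e s = s ++ w.map (s.getD · 0) := by
      rcases List.eq_nil_or_concat s with rfl | ⟨s, y, rfl⟩
      · exact absurd hs.symm ha.ne'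
      · simp only [List.length_concat] at hs
        rw [List.concat_eq_append, blockSubst_append_singleton he, hid s (by omega)]
        simp [e, hs]
    have h2 : w.map ((s ++ [b]).getD · 0) = w.map (s.getD · 0) :=
      List.map_congr_left fun i hi => List.getD_append _ _ _ _ (hs ▸ hwa i hi)
    rw [blockSubst_append_singleton he, h1, hz, List.map_append, List.map_cons, h2]
    simp [e, hs]
  refine ⟨blockSubst e, isSubst_blockSubst he, hid, fun p q hp => ⟨?_, ?_⟩, ?_⟩
  · exact blockSubst_append_of_eq_nil he p q fun t h1 _ => by
      simp only [e]; rw [if_neg, if_neg] <;> omega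
  · rcases List.eq_nil_or_concat p with rfl | ⟨s, y, rfl⟩
    · simp at hp
    · rw [List.concat_eq_append] at hp ⊢
      simp only [List.length_append, List.length_singleton] at hp
      rw [key s y (by omega)]
      simp [z]
      omega
  · have hk : ∀ b < a, c (blockSubst e (List.range a ++ [b])) = k := by
      intro b hb
      rw [← hl ⟨b, hb⟩, key _ _ (by simp)]
      congr 2
      rw [List.map_ofFn]
      congr 1
      funext i
      simp only [Function.comp_apply, Combinatorics.Line.apply_def]
      rcases l.idxFun (σ.symm i) with _ | t
      · simp
      · simp
    intro b hb b' hb'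
    rw [hk b hb, hk b' hb']

/-- After a suitable substitution, the colour of words over `{0, …, a - 1}` of length at most `n`
depends only on their length. The block for the last letter is chosen for all prefixes of length
`a + N` at once, where `N` is the exact length of the image of words with `n` letters; this is why
the induction needs to control exact lengths. -/
theorem exists_isSubst_length_dependent {a : ℕ} (ha : 0 < a) (n : ℕ) (K : Type) [Finite K] :
    ∃ N : ℕ, ∀ c : List ℕ → K, ∃ Φ, IsSubst Φ ∧ (∀ p : List ℕ, p.length < a → Φ p = p) ∧
      (∀ p q : List ℕ, p.length = a + n → Φ (p ++ q) = Φ p ++ q ∧ (Φ p).length = a + N) ∧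
      ∀ q q' : List ℕ, (∀ x ∈ q, x < a) → (∀ x ∈ q', x < a) → q.length = q'.length →
        q.length ≤ n → c (Φ (List.range a ++ q)) = c (Φ (List.range a ++ q')) := by
  induction n generalizing K with
  | zero =>
    refine ⟨0, fun c => ⟨id, IsSubst.id, fun _ _ => rfl, fun _ _ h => ⟨rfl, h⟩, ?_⟩⟩
    intro q q' _ _ h h0
    obtain rfl := List.length_eq_zero_iff.1 (Nat.le_zero.1 h0)
    obtain rfl := List.length_eq_zero_iff.1 h.symm
    rfl
  | succ n ih =>
    obtain ⟨N, hN⟩ := ih (K × K)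
    obtain ⟨M, hM⟩ := exists_isSubst_letter_invariant (a := a + N) (by omega)
      ((Fin (a + N) → Fin a) → K)
    refine ⟨N + M, fun c => ?_⟩
    -- `f` codes a prefix of length `a + N`, as the relabelling which sends `List.range (a + N)` to it
    let ext : (Fin (a + N) → Fin a) → ℕ → ℕ :=
      fun f x => if h : x < a + N then f ⟨x, h⟩ else 0
    obtain ⟨Φ, hΦ, hΦid, hΦtail, hΦc⟩ := hM fun r f => c (r.map (ext f))
    have hlast : ∀ s : List ℕ, s.length = N → (∀ x ∈ s, x < a) → ∀ b < a,
        c (Φ (List.range a ++ s ++ [b])) = c (Φ (List.range a ++ s ++ [0])) := by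
      intro s hs hsa b hb
      let r := List.range a ++ s
      have hr : r.length = a + N := by simp [r, hs]
      have hra : ∀ x ∈ r, x < a := by
        intro x hx
        rcases List.mem_append.1 hx with hx | hx
        · exact List.mem_range.1 hx
        · exact hsa x hx
      let f : Fin (a + N) → Fin a := fun i => ⟨r[i], hra _ (List.getElem_mem _)⟩
      have hf : ∀ b < a, (List.range (a + N) ++ [b]).map (ext f) = r ++ [b] := by
        intro b hb
        rw [List.map_append]
        congr 1
        · refine List.ext_getElem (by simp [hr]) fun i h1 h2 => ?_
          have : i < a + N := by simpa using h1
          simp [ext, f, this]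
        · simp [ext, f, r, hb, Nat.lt_add_right N hb]
      have := congrFun (hΦc b (by omega) 0 (by omega)) f
      simp only [← hΦ.map] at this
      rwa [hf b hb, hf 0 ha] at this
    -- the second colour anticipates the words that have one more letter
    obtain ⟨Ψ, hΨ, hΨid, hΨtail, hΨc⟩ := hN fun r => (c (Φ r), c (Φ (r ++ [0])))
    refine ⟨Φ ∘ Ψ, hΦ.comp hΨ, fun p hp => ?_, fun p q hp => ?_, ?_⟩
    · rw [Function.comp_apply, hΨid p hp, hΦid p (by omega)]
    · rcases List.eq_nil_or_concat p with rfl | ⟨s, y, rfl⟩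
      · simp at hp
      rw [List.concat_eq_append] at hp ⊢
      simp only [List.length_append, List.length_singleton] at hp
      have hs : s.length = a + n := by omega
      have hl : (Ψ s ++ [y]).length = a + N + 1 := by simp [(hΨtail s [] hs).2]
      simp only [Function.comp_apply]
      rw [List.append_assoc, (hΨtail s _ hs).1, (hΨtail s _ hs).1, ← List.append_assoc,
        (hΦtail _ q hl).1, (hΦtail _ q hl).2]
      exact ⟨rfl, by omega⟩
    · intro q q' hq hq' hqq hqn
      simp only [Function.comp_apply]
      rcases Nat.lt_or_ge q.length (n + 1) with hlt | hge
      · exact congrArg Prod.fst (hΨc q q' hq hq' hqq (by omega))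
      have main : ∀ q : List ℕ, (∀ x ∈ q, x < a) → q.length = n + 1 →
          c (Φ (Ψ (List.range a ++ q))) =
            c (Φ (Ψ (List.range a ++ List.replicate n 0) ++ [0])) := by
        intro q hq hqn
        rcases List.eq_nil_or_concat q with rfl | ⟨s, y, rfl⟩
        · simp at hqn
        rw [List.concat_eq_append] at hqn hq ⊢
        have hs : s.length = n := by simpa using hqn
        have hsa : ∀ x ∈ s, x < a := fun x hx => hq x (by simp [hx])
        have hl : (List.range a ++ s).length = a + n := by simp [hs]
        obtain ⟨t, ht, hta⟩ := hΨ.apply_range_append ha hΨid s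
        have htN : t.length = N := by
          have := (hΨtail _ [] hl).2
          rw [ht] at this
          simpa using this
        rw [← List.append_assoc, (hΨtail _ _ hl).1]
        trans c (Φ (Ψ (List.range a ++ s) ++ [0]))
        · rw [ht]
          refine hlast t htN (fun x hx => ?_) y (hq y (by simp))
          rcases List.mem_append.1 (hta x hx) with h | h
          · exact List.mem_range.1 h
          · exact hsa x h
        · exact congrArg Prod.snd (hΨc s (List.replicate n 0) hsa
            (fun x hx => (List.eq_of_mem_replicate hx).symm ▸ ha) (by simp [hs]) hs.le)
      rw [main q hq (by omega), main q' hq' (by omega)]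

/-- The pigeonhole principle: every colouring of a sufficiently long initial segment of `ℕ` is
constant on some `l 0 < ⋯ < l n`. -/
theorem exists_lt_succ_forall_eq (n : ℕ) (K : Type) [Finite K] :
    ∃ M : ℕ, ∀ d : ℕ → K, ∃ l : ℕ → ℕ, (∀ t < n, l t < l (t + 1)) ∧ (∀ t ≤ n, l t ≤ M) ∧
      ∃ k, ∀ t ≤ n, d (l t) = k := by
  classical
  have := Fintype.ofFinite K
  refine ⟨Fintype.card K * n, fun d => ?_⟩
  obtain ⟨k, -, hk⟩ := Finset.exists_lt_card_fiber_of_mul_lt_card_of_maps_to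
    (s := Finset.range (Fintype.card K * n + 1)) (t := Finset.univ) (f := d) (n := n)
    (fun _ _ => Finset.mem_univ _) (by simp)
  obtain ⟨s, hs, hcard⟩ := Finset.exists_subset_card_eq (Nat.succ_le_of_lt hk)
  have hmem : ∀ i, s.orderEmbOfFin hcard i ∈ _ := fun i => hs (s.orderEmbOfFin_mem hcard i)
  refine ⟨fun t => s.orderEmbOfFin hcard (Fin.ofNat (n + 1) t), fun t ht => ?_, fun t _ => ?_, k,
    fun t _ => (Finset.mem_filter.1 (hmem _)).2⟩
  · refine (s.orderEmbOfFin hcard).strictMono (Fin.lt_def.2 ?_)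
    simp [Nat.mod_eq_of_lt, ht, ht.trans (Nat.lt_succ_self n)]
  · have := (Finset.mem_filter.1 (hmem (Fin.ofNat (n + 1) t))).1
    exact Nat.lt_succ_iff.1 (Finset.mem_range.1 this)

/-- After a suitable substitution, all words over `{0, …, a - 1}` of length at most `n` have the same
colour. -/
theorem exists_isSubst_tail_invariant {a : ℕ} (ha : 0 < a) (n : ℕ) (K : Type) [Finite K] :
    ∃ N : ℕ, ∀ c : List ℕ → K, ∃ Φ, IsSubst Φ ∧ (∀ p : List ℕ, p.length < a → Φ p = p) ∧
      (∀ p : List ℕ, p.length ≤ a + n → (Φ p).length ≤ N) ∧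
      ∀ q q' : List ℕ, (∀ x ∈ q, x < a) → (∀ x ∈ q', x < a) → q.length ≤ n → q'.length ≤ n →
        c (Φ (List.range a ++ q)) = c (Φ (List.range a ++ q')) := by
  obtain ⟨M, hM⟩ := exists_lt_succ_forall_eq n K
  obtain ⟨N, hN⟩ := exists_isSubst_length_dependent ha M K
  refine ⟨a + N, fun c => ?_⟩
  obtain ⟨Φ, hΦ, hΦid, hΦtail, hΦc⟩ := hN c
  obtain ⟨l, hl, hlM, k, hk⟩ := hM fun t => c (Φ (List.range a ++ List.replicate t 0))
  -- repeating letters stretches a word with `i` letters after `List.range a` to length `l i`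
  let e : ℕ → List ℕ := fun t =>
    if t + 1 < a then [] else
      if t + 1 = a then List.replicate (l 0) t else
        List.replicate (l (t + 1 - a) - l (t - a) - 1) t
  have he : ∀ t, ∀ i ∈ e t, i ≤ t := by
    intro t i hi
    simp only [e] at hi
    split_ifs at hi
    · simp at hi
    · exact (List.eq_of_mem_replicate hi).le
    · exact (List.eq_of_mem_replicate hi).le
  have hΨ := isSubst_blockSubst he
  have hΨid : ∀ p : List ℕ, p.length < a → blockSubst e p = p := fun p hp =>
    blockSubst_eq_self he p fun t ht => by simp only [e]; rw [if_pos]; omega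
  have hlen : ∀ i ≤ n, ∀ p : List ℕ, p.length = a + i → (blockSubst e p).length = a + l i := by
    intro i
    induction i with
    | zero =>
      intro _ p hp
      rcases List.eq_nil_or_concat p with rfl | ⟨s, y, rfl⟩
      · simp at hp; omega
      rw [List.concat_eq_append] at hp ⊢
      simp only [List.length_append, List.length_singleton] at hp
      have hs : s.length + 1 = a := by omega
      rw [blockSubst_append_singleton he, hΨid s (by omega)]
      simp [e, hs]
      omega
    | succ i ih =>
      intro hi p hp
      rcases List.eq_nil_or_concat p with rfl | ⟨s, y, rfl⟩
      · simp at hp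
      rw [List.concat_eq_append] at hp ⊢
      simp only [List.length_append, List.length_singleton] at hp
      have hs : s.length = a + i := by omega
      have h1 : a + i + 1 - a = i + 1 := by omega
      have := hl i (by omega)
      rw [blockSubst_append_singleton he, List.length_append, ih (by omega) s hs]
      simp only [e, hs, List.length_cons, List.length_map]
      rw [if_neg (by omega), if_neg (by omega), List.length_replicate, h1, Nat.add_sub_cancel_left]
      omega
  refine ⟨Φ ∘ blockSubst e, hΦ.comp hΨ, fun p hp => ?_, fun p hp => ?_, ?_⟩
  · rw [Function.comp_apply, hΨid p hp, hΦid p hp]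
  · have h1 : (blockSubst e p).length ≤ a + M := by
      refine (hΨ.length_mono (q := List.replicate (a + n) 0) (by simpa using hp)).trans ?_
      rw [hlen n le_rfl _ (by simp)]
      exact Nat.add_le_add_left (hlM n le_rfl) a
    refine (hΦ.length_mono (q := List.replicate (a + M) 0) (by simpa using h1)).trans ?_
    exact (hΦtail _ [] (by simp)).2.le
  · have main : ∀ q : List ℕ, (∀ x ∈ q, x < a) → q.length ≤ n →
        c (Φ (blockSubst e (List.range a ++ q))) = k := by
      intro q hq hqn
      obtain ⟨r, hr, hra⟩ := hΨ.apply_range_append ha hΨid q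
      have hrl : r.length = l q.length := by
        have := hlen q.length hqn (List.range a ++ q) (by simp)
        rw [hr] at this
        simpa using this
      rw [hr, ← hk q.length hqn]
      refine hΦc r _ (fun x hx => ?_) (fun x hx => (List.eq_of_mem_replicate hx).symm ▸ ha)
        (by simp [hrl]) (hrl ▸ hlM _ hqn)
      rcases List.mem_append.1 (hra x hx) with h | h
      · exact List.mem_range.1 h
      · exact hq x h
    intro q q' hq hq' hqn hqn'
    simp only [Function.comp_apply]
    rw [main q hq hqn, main q' hq' hqn']

/-! ### The finite dual Ramsey theorem -/

/-- After a suitable substitution, the colour of `p ++ m :: q`, where `p` has length `j` and letters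
`0, …, m - 1`, does not depend on `q`. All `p` are treated at once, by replacing the colour of a
word over the positions `0, …, j` by the family of colours of its relabellings. -/
theorem exists_isSubst_tail_invariant_at (m j n : ℕ) (K : Type) [Finite K] :
    ∃ N : ℕ, ∀ c : List ℕ → K, ∃ Φ, IsSubst Φ ∧ (∀ p : List ℕ, p.length ≤ j → Φ p = p) ∧
      (∀ p : List ℕ, p.length ≤ n → (Φ p).length ≤ N) ∧
      ∀ p q q' : List ℕ, p.length = j → (∀ x, x ∈ p ↔ x < m) → (∀ x ∈ q, x ≤ m) →
        (∀ x ∈ q', x ≤ m) → q.length ≤ n → q'.length ≤ n →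
        c (Φ (p ++ m :: q)) = c (Φ (p ++ m :: q')) := by
  obtain ⟨N, hN⟩ := exists_isSubst_tail_invariant (a := j + 1) (by omega) n
    ((Fin (j + 1) → Fin (m + 1)) → K)
  refine ⟨N, fun c => ?_⟩
  let ext : (Fin (j + 1) → Fin (m + 1)) → ℕ → ℕ :=
    fun f x => if h : x < j + 1 then f ⟨x, h⟩ else 0
  have hext : ∀ f i (h : i < j + 1), ext f i = f ⟨i, h⟩ := fun f i h => dif_pos h
  obtain ⟨Φ, hΦ, hΦid, hΦN, hΦc⟩ := hN fun r f => c (r.map (ext f))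
  refine ⟨Φ, hΦ, fun p hp => hΦid p (by omega), fun p hp => hΦN p (by omega), ?_⟩
  intro p q q' hp hpm hq hq' hqn hqn'
  let s := p ++ [m]
  have hs : s.length = j + 1 := by simp [s, hp]
  have hsm : ∀ x, x ∈ s ↔ x < m + 1 := by
    intro x
    simp only [s, List.mem_append, List.mem_singleton, hpm]
    omega
  let f : Fin (j + 1) → Fin (m + 1) := fun i => ⟨s[i], (hsm _).1 (List.getElem_mem _)⟩
  have hfs : (List.range (j + 1)).map (ext f) = s := by
    refine List.ext_getElem (by simp [hs]) fun i h1 h2 => ?_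
    rw [List.getElem_map, List.getElem_range]
    exact hext f i (hs ▸ h2)
  -- every word over the letters of `s` lifts to a word of positions in `s`
  have lift : ∀ q : List ℕ, (∀ x ∈ q, x ≤ m) →
      ∃ q₀ : List ℕ, (∀ x ∈ q₀, x < j + 1) ∧ q₀.map (ext f) = q := by
    intro q hq
    induction q with
    | nil => exact ⟨[], by simp, rfl⟩
    | cons y q ih =>
      obtain ⟨q₀, h1, h2⟩ := ih fun x hx => hq x (List.mem_cons_of_mem _ hx)
      obtain ⟨i, hi, hy⟩ := List.getElem_of_mem ((hsm y).2 (Nat.lt_succ_of_le (hq y (by simp))))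
      have hi' : i < j + 1 := hs ▸ hi
      refine ⟨i :: q₀, ?_, ?_⟩
      · rintro x (_ | ⟨_, hx⟩)
        exacts [hi', h1 x hx]
      · rw [List.map_cons, h2, hext f i hi']
        exact congrArg (· :: q) hy
  obtain ⟨r, hr, hrq⟩ := lift q hq
  obtain ⟨r', hr', hrq'⟩ := lift q' hq'
  have := congrFun (hΦc r r' hr hr' (by simpa [← hrq] using hqn)
    (by simpa [← hrq'] using hqn')) f
  simp only [← hΦ.map, List.map_append, hfs, hrq, hrq'] at this
  simpa [s] using this

/-- Fusion of `exists_isSubst_tail_invariant_at` over all lengths of `p` less than `j`. The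
substitution that treats length `j` fixes the words of length at most `j`, so that it does not
disturb what was achieved for shorter `p`. -/
theorem exists_isSubst_tail_invariant_below (m j n : ℕ) (K : Type) [Finite K] :
    ∃ N : ℕ, ∀ c : List ℕ → K, ∃ Φ, IsSubst Φ ∧
      (∀ p : List ℕ, p.length ≤ n → (Φ p).length ≤ N) ∧
      ∀ p q q' : List ℕ, p.length < j → (∀ x, x ∈ p ↔ x < m) → (∀ x ∈ q, x ≤ m) →
        (∀ x ∈ q', x ≤ m) → (p ++ m :: q).length ≤ n → (p ++ m :: q').length ≤ n →
        c (Φ (p ++ m :: q)) = c (Φ (p ++ m :: q')) := by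
  induction j generalizing n with
  | zero => exact ⟨n, fun c => ⟨id, IsSubst.id, fun _ h => h, by simp⟩⟩
  | succ j ih =>
    obtain ⟨n₁, h₁⟩ := exists_isSubst_tail_invariant_at m j n K
    obtain ⟨N, hN⟩ := ih n₁
    refine ⟨N, fun c => ?_⟩
    obtain ⟨Φ, hΦ, hΦN, hΦc⟩ := hN c
    obtain ⟨Ψ, hΨ, hΨid, hΨN, hΨc⟩ := h₁ (c ∘ Φ)
    refine ⟨Φ ∘ Ψ, hΦ.comp hΨ, fun p hp => hΦN _ (hΨN p hp), ?_⟩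
    intro p q q' hp hpm hq hq' hqn hqn'
    rcases Nat.lt_succ_iff_lt_or_eq.1 hp with hlt | heq
    · have step : ∀ q : List ℕ, (∀ x ∈ q, x ≤ m) → (p ++ m :: q).length ≤ n →
          ∃ r, Ψ (p ++ m :: q) = p ++ m :: r ∧ (∀ x ∈ r, x ≤ m) ∧
            (p ++ m :: r).length ≤ n₁ := by
        intro q hq hqn
        obtain ⟨r, hr⟩ := hΨ.append_cons p m q
        rw [hΨid p hlt.le] at hr
        refine ⟨r, hr, fun x hx => ?_, hr ▸ hΨN _ hqn⟩
        have : x ∈ p ++ m :: q := hΨ.subset _ (by rw [hr]; simp [hx])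
        simp only [List.mem_append, List.mem_cons, hpm] at this
        rcases this with h | h | h
        exacts [h.le, h.le, hq x h]
      obtain ⟨r, hr, hrm, hrn⟩ := step q hq hqn
      obtain ⟨r', hr', hrm', hrn'⟩ := step q' hq' hqn'
      simp only [Function.comp_apply, hr, hr']
      exact hΦc p r r' hlt hpm hrm hrm' hrn hrn'
    · simp only [List.length_append, List.length_cons] at hqn hqn'
      exact hΨc p q q' heq hpm hq hq' (by omega) (by omega)

/-- A word with letters exactly `0, …, m - 1` whose first occurrences are in increasing order; that
is, a rigid surjection from the positions of the word onto `{0, …, m - 1}`. -/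
structure IsRigid (m : ℕ) (p : List ℕ) : Prop where
  mem_iff : ∀ x, x ∈ p ↔ x < m
  mem_of_lt : ∀ s j t, p = s ++ j :: t → ∀ i < j, i ∈ s

theorem IsRigid.exists_eq_append_cons {m : ℕ} {p : List ℕ} (h : IsRigid (m + 1) p) :
    ∃ s q, p = s ++ m :: q ∧ IsRigid m s ∧ ∀ x ∈ q, x ≤ m := by
  obtain ⟨s, q, rfl, hs⟩ := List.eq_append_cons_of_mem ((h.mem_iff m).2 (Nat.lt_succ_self m))
  refine ⟨s, q, rfl, ⟨fun x => ⟨fun hx => ?_, fun hx => h.mem_of_lt s m q rfl x hx⟩, ?_⟩, ?_⟩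
  · exact lt_of_le_of_ne (Nat.lt_succ_iff.1 ((h.mem_iff x).1 (by simp [hx])))
      fun e => hs (e ▸ hx)
  · rintro s' j t rfl i hi
    exact h.mem_of_lt s' j (t ++ m :: q) (by simp) i hi
  · exact fun x hx => Nat.lt_succ_iff.1 ((h.mem_iff x).1 (by simp [hx]))

/-- The finite dual Ramsey theorem, for rigid words of all lengths up to `n`. -/
theorem exists_isSubst_rigid_monochromatic (m n : ℕ) (K : Type) [Finite K] :
    ∃ N : ℕ, ∀ c : List ℕ → K, ∃ Φ, IsSubst Φ ∧
      (∀ p : List ℕ, p.length ≤ n → (Φ p).length ≤ N) ∧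
      ∃ k, ∀ p : List ℕ, IsRigid m p → p.length ≤ n → c (Φ p) = k := by
  induction m generalizing n with
  | zero =>
    refine ⟨n, fun c => ⟨id, IsSubst.id, fun _ h => h, c [], fun p hp _ => ?_⟩⟩
    rw [List.eq_nil_iff_forall_not_mem.2 fun x hx => Nat.not_lt_zero x ((hp.mem_iff x).1 hx)]
    rfl
  | succ m ih =>
    obtain ⟨n₁, h₁⟩ := ih n
    obtain ⟨N, hN⟩ := exists_isSubst_tail_invariant_below m n₁ n₁ K
    refine ⟨N, fun c => ?_⟩
    obtain ⟨Φ, hΦ, hΦN, hΦc⟩ := hN c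
    -- after `Φ`, the colour of `p ++ m :: q` is that of `p ++ [m]`
    obtain ⟨Ψ, hΨ, hΨN, k, hk⟩ := h₁ fun p => c (Φ (p ++ [m]))
    refine ⟨Φ ∘ Ψ, hΦ.comp hΨ, fun p hp => hΦN _ (hΨN p hp), k, fun p hp hpn => ?_⟩
    obtain ⟨s, q, rfl, hs, hq⟩ := hp.exists_eq_append_cons
    obtain ⟨r, hr⟩ := hΨ.append_cons s m q
    have hlen := hΨN _ hpn
    rw [hr] at hlen
    simp only [List.length_append, List.length_cons] at hlen hpn
    rw [← hk s hs (by omega), Function.comp_apply, hr]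
    refine hΦc (Ψ s) r [] (by omega)
      (fun x => (hΨ.mem_iff s x).trans (hs.mem_iff x)) (fun x hx => ?_) (by simp)
      (by simp; omega) (by simp; omega)
    have : x ∈ s ++ m :: q := hΨ.subset _ (by rw [hr]; simp [hx])
    exact Nat.lt_succ_iff.1 ((hp.mem_iff x).1 this)

/-! ### Embeddings and copies -/

namespace LinOrdPoset

theorem IsEmbedding.of_le_iff_of_lt {A : LinOrdPoset.{u}} {B : LinOrdPoset.{v}}
    {f : A.carrier → B.carrier} (hle : ∀ a b, A.le a b ↔ B.le (f a) (f b))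
    (hlt : ∀ a b, A.lt a b → B.lt (f a) (f b)) : IsEmbedding A B f where
  injective a b h := A.le_antisymm a b ((hle a b).2 (h ▸ B.le_refl _))
    ((hle b a).2 (h ▸ B.le_refl _))
  le_iff := hle
  lt_iff a b := by
    refine ⟨hlt a b, fun h => ?_⟩
    rcases A.lt_trichotomy a b with h' | rfl | h'
    · exact h'
    · exact absurd h (B.lt_irrefl _)
    · exact absurd (B.lt_trans _ _ _ h (hlt b a h')) (B.lt_irrefl _)

/-- Copies of `A` are the ranges of embeddings of `A`. -/
theorem mem_copies_iff {A : LinOrdPoset.{u}} {C : LinOrdPoset.{v}} {S : Set C.carrier} :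
    S ∈ C.copies A ↔ ∃ f, IsEmbedding A C f ∧ Set.range f = S := by
  constructor
  · rintro ⟨f, hf, hs⟩
    refine ⟨fun a => (f a).1, ⟨Subtype.val_injective.comp hf.injective, hf.le_iff,
      hf.lt_iff⟩, ?_⟩
    ext x
    constructor
    · rintro ⟨a, rfl⟩
      exact (f a).2
    · intro hx
      obtain ⟨a, ha⟩ := hs ⟨x, hx⟩
      exact ⟨a, congrArg Subtype.val ha⟩
  · rintro ⟨f, hf, rfl⟩
    refine ⟨fun a => ⟨f a, a, rfl⟩, ⟨fun a b h => hf.injective (congrArg Subtype.val h),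
      hf.le_iff, hf.lt_iff⟩, ?_⟩
    rintro ⟨_, a, rfl⟩
    exact ⟨a, rfl⟩

theorem IsEmbedding.comp {A : LinOrdPoset.{u}} {B : LinOrdPoset.{v}} {C : LinOrdPoset.{w}}
    {g : B.carrier → C.carrier} {f : A.carrier → B.carrier} (hg : IsEmbedding B C g)
    (hf : IsEmbedding A B f) : IsEmbedding A C (g ∘ f) :=
  ⟨hg.injective.comp hf.injective, fun a b => (hf.le_iff a b).trans (hg.le_iff _ _),
    fun a b => (hf.lt_iff a b).trans (hg.lt_iff _ _)⟩

theorem IsEmbedding.of_comp {A : LinOrdPoset.{u}} {B : LinOrdPoset.{v}} {C : LinOrdPoset.{w}}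
    {g : B.carrier → C.carrier} {f : A.carrier → B.carrier} (hg : IsEmbedding B C g)
    (hgf : IsEmbedding A C (g ∘ f)) : IsEmbedding A B f :=
  ⟨hgf.injective.of_comp, fun a b => (hgf.le_iff a b).trans (hg.le_iff _ _).symm,
    fun a b => (hgf.lt_iff a b).trans (hg.lt_iff _ _).symm⟩

theorem IsEmbedding.image_mem_copies {A : LinOrdPoset.{u}} {P : LinOrdPoset.{v}}
    {Q : LinOrdPoset.{w}} {e : P.carrier → Q.carrier} (he : IsEmbedding P Q e)
    {S : Set P.carrier} (hS : S ∈ P.copies A) : e '' S ∈ Q.copies A := by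
  obtain ⟨f, hf, rfl⟩ := mem_copies_iff.1 hS
  exact mem_copies_iff.2 ⟨_, he.comp hf, Set.range_comp _ _⟩

theorem Arrow.of_isomorphic {P : LinOrdPoset.{w}} {Q : LinOrdPoset.{x}} {A : LinOrdPoset.{u}}
    {B : LinOrdPoset.{v}} {k : ℕ} (h : Arrow Q B A k) (hPQ : Isomorphic P Q) :
    Arrow P B A k := by
  obtain ⟨e, he, hs⟩ := hPQ
  have hinv := Function.rightInverse_surjInv hs
  have he' : IsEmbedding Q P (Function.surjInv hs) :=
    he.of_comp (by rw [hinv.comp_eq_id]; exact ⟨fun _ _ h => h, fun _ _ => .rfl, fun _ _ => .rfl⟩)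
  intro χ
  obtain ⟨B', hB', j, hj⟩ := h fun S => χ ⟨_, he'.image_mem_copies S.2⟩
  refine ⟨_, he'.image_mem_copies hB', j, ?_⟩
  rintro ⟨A', hA'⟩ hsub
  obtain ⟨f, hf, rfl⟩ := mem_copies_iff.1 hA'
  have himg : Function.surjInv hs '' Set.range (e ∘ f) = Set.range f := by
    rw [← Set.range_comp]
    congr 1
    funext a
    exact he.injective (hinv _)
  have hmem : Set.range (e ∘ f) ∈ Q.copies A := mem_copies_iff.2 ⟨_, he.comp hf, rfl⟩
  rw [← hj ⟨_, hmem⟩ ?_]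
  · congr 1
    exact Subtype.ext himg.symm
  · rintro _ ⟨a, rfl⟩
    obtain ⟨b, hb, hba⟩ := hsub ⟨a, rfl⟩
    have : b = e (f a) := by rw [← hba, hinv]
    rw [Function.comp_apply, ← this]
    exact hb

/-! ### Enumerating the downsets of a finite poset -/

/-- `E` is closed downwards in the partial order. -/
def IsDownset (A : LinOrdPoset.{u}) (E : Set A.carrier) : Prop :=
  ∀ a b, A.le a b → b ∈ E → a ∈ E

/-- The strict colexicographic order on subsets, with respect to the linear order of `A`: for finite
sets, the last element at which `E` and `F` differ belongs to `F`. -/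
def ColexLT (A : LinOrdPoset.{u}) (E F : Set A.carrier) : Prop :=
  ∃ a ∈ F, a ∉ E ∧ ∀ b ∈ E, b ∉ F → A.lt b a

/-- `D 0, …, D (m - 1)` lists all downsets of `A` in increasing colexicographic order. For `i ≥ m`
the value `D i` is only required to be some downset. -/
structure IsDownsetEnum (A : LinOrdPoset.{u}) (m : ℕ) (D : ℕ → Set A.carrier) : Prop where
  isDownset : ∀ i, A.IsDownset (D i)
  exists_eq : ∀ E, A.IsDownset E → ∃ i < m, D i = E
  lt_iff : ∀ i < m, ∀ j < m, i < j ↔ A.ColexLT (D i) (D j)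

/-- The linear order of `A` as a Mathlib `LinearOrder`. -/
noncomputable abbrev toLinearOrder (A : LinOrdPoset.{u}) : LinearOrder A.carrier :=
  haveI : IsStrictTotalOrder A.carrier A.lt :=
    { trichotomous := fun a b h h' => ((A.lt_trichotomy a b).resolve_left h).resolve_right h'
      irrefl := A.lt_irrefl
      trans := A.lt_trans }
  haveI := Classical.decRel A.lt
  linearOrderOfSTO A.lt

theorem exists_isDownsetEnum (A : LinOrdPoset.{u}) (hA : Finite A.carrier) :
    ∃ m D, A.IsDownsetEnum m D := by
  classical
  let := A.toLinearOrder
  have := Fintype.ofFinite A.carrier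
  let X := {E : Colex (Finset A.carrier) // A.IsDownset (ofColex E : Finset A.carrier)}
  have : Finite (Colex (Finset A.carrier)) := inferInstanceAs (Finite (Finset A.carrier))
  have : Fintype X := Fintype.ofFinite X
  let σ : Fin (Fintype.card X) ≃o X := Fintype.orderIsoFinOfCardEq X rfl
  let D : ℕ → Set A.carrier := fun i =>
    if h : i < Fintype.card X then (ofColex (σ ⟨i, h⟩).1 : Finset A.carrier) else ∅
  have hD : ∀ i (h : i < Fintype.card X), D i = (ofColex (σ ⟨i, h⟩).1 : Finset A.carrier) :=
    fun i h => dif_pos h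
  refine ⟨Fintype.card X, D, fun i => ?_, fun E hE => ?_, fun i hi j hj => ?_⟩
  · by_cases h : i < Fintype.card X
    · rw [hD i h]
      exact (σ ⟨i, h⟩).2
    · simp [D, h, IsDownset]
  · let x : X := ⟨toColex E.toFinset, by simpa using hE⟩
    refine ⟨σ.symm x, (σ.symm x).2, ?_⟩
    rw [hD _ (σ.symm x).2]
    simp [x]
  · rw [hD i hi, hD j hj]
    have h1 : i < j ↔ σ ⟨i, hi⟩ < σ ⟨j, hj⟩ := by simp
    rw [h1, ← Subtype.coe_lt_coe]
    exact Finset.Colex.toColex_lt_toColex_iff_exists_forall_lt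
     (s := ofColex (σ ⟨i, hi⟩).1) (t := ofColex (σ ⟨j, hj⟩).1)

/-! ### Words over downsets and maps into `Π_N` -/

section words

variable {A : LinOrdPoset.{u}} {B : LinOrdPoset.{v}} {m n : ℕ}
  {D : ℕ → Set A.carrier} {D' : ℕ → Set B.carrier}

theorem isDownset_le (A : LinOrdPoset.{u}) (a : A.carrier) : A.IsDownset {x | A.le x a} :=
  fun x y hxy hy => A.le_trans x y a hxy hy

theorem lt_of_le_of_lt (A : LinOrdPoset.{u}) {a b c : A.carrier} (h : A.le a b) (h' : A.lt b c) :
    A.lt a c := by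
  by_cases hab : a = b
  · exact hab ▸ h'
  · exact A.lt_trans a b c (A.lt_of_le_of_ne a b h hab) h'

theorem IsDownsetEnum.le_of_subset (hD : A.IsDownsetEnum m D) {i j : ℕ} (hi : i < m) (hj : j < m)
    (h : D i ⊆ D j) : i ≤ j := by
  by_contra hlt
  obtain ⟨a, ha, ha', -⟩ := (hD.lt_iff j hj i hi).1 (not_le.1 hlt)
  exact ha' (h ha)

open Classical in
/-- The map into the subsets of `Fin N` coded by the word `r` over the sets `D j`: a position `x`
belongs to the image of `a` if the letter at `x` exists and contains `a`. -/
noncomputable def wordMap {α : Type*} (D : ℕ → Set α) (N : ℕ) (r : List ℕ) (a : α) :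
    Finset (Fin N) :=
  {x | ∃ j, r[(x : ℕ)]? = some j ∧ a ∈ D j}

theorem mem_wordMap {α : Type*} {D : ℕ → Set α} {N : ℕ} {r : List ℕ} {a : α} {x : Fin N} :
    x ∈ wordMap D N r a ↔ ∃ j, r[(x : ℕ)]? = some j ∧ a ∈ D j := by
  simp [wordMap]

/-- The image of the list of all downsets under a substitution codes an embedding into `Π_N`. -/
theorem IsDownsetEnum.isEmbedding_wordMap (hD : A.IsDownsetEnum m D) {Φ : List ℕ → List ℕ}
    (hΦ : IsSubst Φ) {N : ℕ} (hN : (Φ (List.range m)).length ≤ N) :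
    IsEmbedding A (PiPoset N) (wordMap D N (Φ (List.range m))) := by
  -- every letter `j` has a position in the word which is preceded by smaller letters only
  have hpos : ∀ j < m, ∃ x : Fin N, (Φ (List.range m))[(x : ℕ)]? = some j ∧
      ∀ y < x, ∃ i < j, (Φ (List.range m))[(y : ℕ)]? = some i := by
    intro j hj
    have hr : List.range m = List.range j ++ j :: (List.range (m - j - 1)).map (j + 1 + ·) := by
      have : m = j + 1 + (m - j - 1) := by omega
      conv_lhs => rw [this, List.range_add, List.range_succ]
      simp
    obtain ⟨t, ht⟩ := hΦ.append_cons (List.range j) j ((List.range (m - j - 1)).map (j + 1 + ·))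
    rw [← hr] at ht
    refine ⟨⟨(Φ (List.range j)).length, ?_⟩, ?_, fun y hy => ?_⟩
    · refine lt_of_lt_of_le ?_ hN
      rw [ht]
      simp
    · simp [ht]
    · have hy' : (y : ℕ) < (Φ (List.range j)).length := hy
      refine ⟨(Φ (List.range j))[(y : ℕ)], ?_, ?_⟩
      · exact List.mem_range.1 (hΦ.subset _ (List.getElem_mem _))
      · rw [ht, List.getElem?_append_left hy', List.getElem?_eq_getElem hy']
  refine .of_le_iff_of_lt (fun a b => ⟨fun hab x hx => ?_, fun hab => ?_⟩) (fun a b hab => ?_)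
  · obtain ⟨j, hj, hb⟩ := mem_wordMap.1 hx
    exact mem_wordMap.2 ⟨j, hj, hD.isDownset j a b hab hb⟩
  · obtain ⟨j, hj, hDj⟩ := hD.exists_eq _ (A.isDownset_le b)
    obtain ⟨x, hx, -⟩ := hpos j hj
    have hxb : x ∈ wordMap D N (Φ (List.range m)) b :=
      mem_wordMap.2 ⟨j, hx, hDj ▸ A.le_refl b⟩
    obtain ⟨i, hi, ha⟩ := mem_wordMap.1 (hab hxb)
    obtain rfl : j = i := Option.some_injective _ (hx.symm.trans hi)
    rw [hDj] at ha
    exact ha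
  -- for `a < b`, the first position of the principal downset of `a` is the first one at which the
  -- images of `a` and `b` differ: no downset that contains `a` or `b` precedes it
  · obtain ⟨j, hj, hDj⟩ := hD.exists_eq _ (A.isDownset_le a)
    obtain ⟨x, hx, hxlt⟩ := hpos j hj
    refine (clexLT_iff _ _).2 ⟨x, mem_wordMap.2 ⟨j, hx, hDj ▸ A.le_refl a⟩, fun hxb => ?_,
      fun y hy => ?_⟩
    · obtain ⟨i, hi, hb⟩ := mem_wordMap.1 hxb
      obtain rfl : j = i := Option.some_injective _ (hx.symm.trans hi)
      rw [hDj] at hb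
      exact A.lt_irrefl b (A.lt_of_le_of_lt hb hab)
    · obtain ⟨i, hij, hi⟩ := hxlt y hy
      have him : i < m := hij.trans hj
      have hno : ∀ c, (c ∈ D i → j ≤ i) → y ∉ wordMap D N (Φ (List.range m)) c := by
        intro c hc hyc
        obtain ⟨i', hi', hci⟩ := mem_wordMap.1 hyc
        obtain rfl : i = i' := Option.some_injective _ (hi.symm.trans hi')
        exact absurd (hc hci) (not_le.2 hij)
      refine iff_of_false (hno a fun ha => ?_) (hno b fun hb => ?_)
      · refine hD.le_of_subset hj him ?_
        rw [hDj]
        exact fun c hc => hD.isDownset i c a hc ha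
      · refine ((hD.lt_iff j hj i him).2 ⟨b, hb, ?_, ?_⟩).le
        · rw [hDj]
          exact fun hba => A.lt_irrefl b (A.lt_of_le_of_lt hba hab)
        · rw [hDj]
          exact fun c hc _ => A.lt_of_le_of_lt hc hab

/-- Pulling back all downsets of `B`, in order, along an embedding `A → B` gives a rigid word over
the downsets of `A`. -/
theorem IsDownsetEnum.isRigid_map_range (hD : A.IsDownsetEnum m D) (hD' : B.IsDownsetEnum n D')
    {g : A.carrier → B.carrier} (hg : IsEmbedding A B g) {γ : ℕ → ℕ} (hγm : ∀ j, γ j < m)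
    (hγ : ∀ j, D (γ j) = g ⁻¹' D' j) : IsRigid m ((List.range n).map γ) := by
  -- the least downset of `B` which pulls back to `D i`
  have hmin : ∀ i < m, ∃ t < n, γ t = i ∧ D' t = {y | ∃ x ∈ D i, B.le y (g x)} := by
    intro i hi
    obtain ⟨t, ht, hDt⟩ := hD'.exists_eq {y | ∃ x ∈ D i, B.le y (g x)} (by
      rintro y z hyz ⟨x, hx, hz⟩
      exact ⟨x, hx, B.le_trans _ _ _ hyz hz⟩)
    have : D (γ t) = D i := by
      rw [hγ, hDt]
      ext a
      constructor
      · rintro ⟨x, hx, hax⟩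
        exact hD.isDownset i a x ((hg.le_iff a x).2 hax) hx
      · exact fun ha => ⟨a, ha, B.le_refl _⟩
    exact ⟨t, ht, Nat.le_antisymm (hD.le_of_subset (hγm t) hi this.le)
      (hD.le_of_subset hi (hγm t) this.ge), hDt⟩
  refine ⟨fun x => ⟨fun hx => ?_, fun hx => ?_⟩, fun s j t hst i hij => ?_⟩
  · obtain ⟨t, -, rfl⟩ := List.mem_map.1 hx
    exact hγm t
  · obtain ⟨t, ht, rfl, -⟩ := hmin x hx
    exact List.mem_map_of_mem (List.mem_range.2 ht)
  · have hlen : s.length < n := by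
      have := congrArg List.length hst
      simp only [List.length_map, List.length_range, List.length_append, List.length_cons] at this
      omega
    have hj : γ s.length = j := by
      have := congrArg (·[s.length]?) hst
      simpa [hlen] using this
    have hjm : j < m := hj ▸ hγm _
    obtain ⟨ti, hti, hi, hDi⟩ := hmin i (hij.trans hjm)
    obtain ⟨tj, htj, -, hDj⟩ := hmin j hjm
    obtain ⟨e, heE, heF, he⟩ := (hD.lt_iff i (hij.trans hjm) j hjm).1 hij
    -- `e`, the last difference of `D i` and `D j`, is mapped to a witness for the generated downsets
    have h1 : ti < tj := by
      refine (hD'.lt_iff ti hti tj htj).2 ?_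
      rw [hDi, hDj]
      refine ⟨g e, ⟨e, heE, B.le_refl _⟩, ?_, ?_⟩
      · rintro ⟨x, hx, hex⟩
        exact heF (hD.isDownset i e x ((hg.le_iff e x).2 hex) hx)
      · rintro y ⟨x, hx, hyx⟩ hy
        exact B.lt_of_le_of_lt hyx ((hg.lt_iff x e).1 (he x hx fun hxj => hy ⟨x, hxj, hyx⟩))
    have h2 : tj ≤ s.length := by
      refine hD'.le_of_subset htj hlen ?_
      rw [hDj]
      rintro y ⟨x, hx, hyx⟩
      refine hD'.isDownset _ y (g x) hyx ?_
      rw [← hj, hγ] at hx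
      exact hx
    have h3 : ti < s.length := h1.trans_le h2
    have : s[ti]? = some i := by
      have := congrArg (·[ti]?) hst
      simpa [List.getElem?_append_left h3, hti, hi] using this.symm
    exact List.mem_of_getElem? this

/-- Words that do not code a copy of `A` receive an arbitrary colour; they do not arise from the
copies of `A` inside the copy of `B`. -/
theorem exists_arrow_piPoset {k : ℕ} (hk : 2 ≤ k) (A : LinOrdPoset.{u}) (B : LinOrdPoset.{v})
    (hA : Finite A.carrier) (hB : Finite B.carrier) : ∃ N, 1 ≤ N ∧ Arrow (PiPoset N) B A k := by
  classical
  obtain ⟨m, D, hD⟩ := A.exists_isDownsetEnum hA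
  obtain ⟨n, D', hD'⟩ := B.exists_isDownsetEnum hB
  obtain ⟨N, hN⟩ := exists_isSubst_rigid_monochromatic m n (Fin k)
  refine ⟨N + 1, by omega, fun χ => ?_⟩
  obtain ⟨Φ, hΦ, hΦN, j, hj⟩ := hN fun r =>
    if h : Set.range (wordMap D (N + 1) r) ∈ (PiPoset (N + 1)).copies A then χ ⟨_, h⟩
    else ⟨0, by omega⟩
  have hemb := hD'.isEmbedding_wordMap hΦ (N := N + 1)
    ((hΦN _ (by simp)).trans (Nat.le_succ N))
  refine ⟨_, mem_copies_iff.2 ⟨_, hemb, rfl⟩, j, ?_⟩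
  rintro ⟨A', hA'⟩ hsub
  obtain ⟨f, hf, rfl⟩ := mem_copies_iff.1 hA'
  choose g hgf using fun a => hsub ⟨a, rfl⟩
  obtain rfl : wordMap D' (N + 1) (Φ (List.range n)) ∘ g = f := funext hgf
  have hg : IsEmbedding A B g := hemb.of_comp hf
  -- `γ` sends the index of a downset of `B` to that of its preimage under `g`
  choose γ hγm hγ using fun i => hD.exists_eq (g ⁻¹' D' i) fun a b hab hb =>
    hD'.isDownset i _ _ ((hg.le_iff a b).1 hab) hb
  have hmap : wordMap D (N + 1) (Φ ((List.range n).map γ)) =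
      wordMap D' (N + 1) (Φ (List.range n)) ∘ g := by
    funext a
    ext x
    rw [Function.comp_apply, mem_wordMap, mem_wordMap, hΦ.map, List.getElem?_map]
    simp [hγ]
  have := hj _ (hD.isRigid_map_range hD' hg hγm hγ) (by simp)
  rw [← this, dif_pos (by rw [hmap]; exact hA')]
  congr 1
  exact Subtype.ext (congrArg Set.range hmap.symm)

end words

/-! ### Classes with the Ramsey property -/

theorem hasRamseyProperty_of_forall_piPoset {K : LinOrdPoset.{w} → Prop}
    (hK : ∀ n : ℕ, 1 ≤ n → ∃ P : LinOrdPoset.{w}, K P ∧ Isomorphic P (PiPoset n)) :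
    HasRamseyProperty K := by
  intro A B _ _ hA hB _ k hk
  obtain ⟨N, hN, h⟩ := exists_arrow_piPoset hk A B hA hB
  obtain ⟨P, hP, hiso⟩ := hK N hN
  refine ⟨P, hP, ?_, h.of_isomorphic hiso⟩
  obtain ⟨e, he, -⟩ := hiso
  have : Finite (PiPoset N).carrier := inferInstanceAs (Finite (Finset (Fin N)))
  exact Finite.of_injective e he.injective

/-- An isomorphic copy of `A` in a possibly larger universe. -/
def ulift (A : LinOrdPoset.{u}) : LinOrdPoset.{max u w} where
  carrier := ULift.{w} A.carrier
  le a b := A.le a.down b.down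
  lt a b := A.lt a.down b.down
  le_refl a := A.le_refl _
  le_trans _ _ _ := A.le_trans _ _ _
  le_antisymm _ _ h h' := ULift.down_injective (A.le_antisymm _ _ h h')
  lt_irrefl _ := A.lt_irrefl _
  lt_trans _ _ _ := A.lt_trans _ _ _
  lt_trichotomy a b := by
    simpa only [ULift.ext_iff] using A.lt_trichotomy a.down b.down
  lt_of_le_of_ne _ _ h h' := A.lt_of_le_of_ne _ _ h fun e => h' (ULift.down_injective e)

theorem ulift_isomorphic (A : LinOrdPoset.{u}) : Isomorphic (ulift.{u, w} A) A :=
  ⟨ULift.down, ⟨ULift.down_injective, fun _ _ => .rfl, fun _ _ => .rfl⟩, ULift.down_surjective⟩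

end LinOrdPoset

theorem theorem3p2 :
    (∀ k : ℕ, 2 ≤ k → ∀ (A : LinOrdPoset.{u}) (B : LinOrdPoset.{v}),
      Finite A.carrier → Finite B.carrier → LinOrdPoset.Embeds A B →
        ∃ N : ℕ, 1 ≤ N ∧ LinOrdPoset.Arrow (LinOrdPoset.PiPoset N) B A k) ∧
    (∀ K : LinOrdPoset.{w} → Prop,
      (∀ n : ℕ, 1 ≤ n → ∃ P : LinOrdPoset.{w}, K P ∧
        LinOrdPoset.Isomorphic P (LinOrdPoset.PiPoset n)) →
      LinOrdPoset.HasRamseyProperty K) ∧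
    LinOrdPoset.HasRamseyProperty (fun P : LinOrdPoset.{w} => Finite P.carrier) ∧
    LinOrdPoset.HasRamseyProperty (fun _ : LinOrdPoset.{w} => True) := by
  refine ⟨fun k hk A B hA hB _ => LinOrdPoset.exists_arrow_piPoset hk A B hA hB,
    fun K hK => LinOrdPoset.hasRamseyProperty_of_forall_piPoset hK,
    LinOrdPoset.hasRamseyProperty_of_forall_piPoset fun n _ => ?_,
    LinOrdPoset.hasRamseyProperty_of_forall_piPoset fun n _ => ?_⟩
  · exact ⟨_, inferInstanceAs (Finite (ULift (Finset (Fin n)))),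
      LinOrdPoset.ulift_isomorphic.{0, w} (LinOrdPoset.PiPoset n)⟩
  · exact ⟨_, trivial, LinOrdPoset.ulift_isomorphic.{0, w} (LinOrdPoset.PiPoset n)⟩
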